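/- Let $p\ge 2$, let $n\ge 1$, and let $X_1,\dots,X_n$ be independent and identically distributed real random variables having a density function $f$ on $\mathbb{R}_+=[0,\infty)$. Suppose that $X_1^p$ has a log-concave density function, that is, a density $g:\mathbb{R}\to[0,\infty)$ with $g(\alpha x+(1-\alpha)y)\ge g(x)^{\alpha}g(y)^{1-\alpha}$ for all $x,y\in\mathbb{R}$ and $\alpha\in[0,1]$. For a vector $x\in\mathbb{R}^n$ let $x_{(1)}\le x_{(2)}\le\cdots\le x_{(n)}$ be the increasing arrangement of its components. For $x,y\in\mathbb{R}^n$ write $y\succeq^{\mathrm w}x$ ($x$ is weakly supmajorized by $y$) if $\sum_{i=1}^{j}x_{(i)}\ge\sum_{i=1}^{j}y_{(i)}$ for every $j=1,\dots,n$. For real random variables $U,V$ write $U\le_{\mathrm{st}}V$ (usual stochastic order) if $P(U\le t)\ge P(V\le t)$ for all $t\in\mathbb{R}$. Then, for all $\mathbf a=(a_1,\dots,a_n),\ \mathbf b=(b_1,\dots,b_n)\in[1,\infty)^n$, $$(e^{a_1},\dots,e^{a_n})\succeq^{\mathrm w}(e^{b_1},\dots,e^{b_n})\quad\Longrightarrow\quad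 \sum_{i=1}^n a_iX_i\le_{\mathrm{st}}\sum_{i=1}^n b_iX_i .$$ -/

import Mathlib

open MeasureTheory ProbabilityTheory

/-- The increasing arrangement `x₍₁₎ ≤ x₍₂₎ ≤ ⋯ ≤ x₍ₙ₎` of the components of `x`. -/
noncomputable def incArrangement {n : ℕ} (x : Fin n → ℝ) : Fin n → ℝ :=
  x ∘ Tuple.sort x

/-- `x` is weakly supmajorized by `y`: for every `j = 1, …, n`, the sum of the `j` smallest
components of `x` is at least the sum of the `j` smallest components of `y`. -/
def WeaklySupmajorizedBy {n : ℕ} (x y : Fin n → ℝ) : Prop :=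
  ∀ j : Fin n, ∑ i ∈ Finset.Iic j, incArrangement y i ≤ ∑ i ∈ Finset.Iic j, incArrangement x i

/-- The nonnegative function `h` is log-concave on the convex set `A`. -/
def LogConcaveOn (A : Set ℝ) (h : ℝ → ℝ) : Prop :=
  Convex ℝ A ∧ (∀ x ∈ A, 0 ≤ h x) ∧
    ∀ x ∈ A, ∀ y ∈ A, ∀ α ∈ Set.Icc (0 : ℝ) 1,
      h x ^ α * h y ^ (1 - α) ≤ h (α * x + (1 - α) * y)

/-- `f` is a density function, on the set `A`, of the real random variable `X`
(so `X` takes values in `A` almost surely). -/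
def IsDensityOn {Ω : Type*} [MeasurableSpace Ω] (μ : Measure Ω) (X : Ω → ℝ) (A : Set ℝ)
    (f : ℝ → ℝ) : Prop :=
  Measurable f ∧ (∀ x ∈ A, 0 ≤ f x) ∧
    μ.map X = (volume.restrict A).withDensity (fun x => ENNReal.ofReal (f x))

/-- The real random variable `X` has a log-concave density function on the real line. -/
def HasLogConcaveDensity {Ω : Type*} [MeasurableSpace Ω] (μ : Measure Ω) (X : Ω → ℝ) : Prop :=
  ∃ g : ℝ → ℝ, IsDensityOn μ X Set.univ g ∧ LogConcaveOn Set.univ g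

/-- The usual stochastic order `X ≤_st Y`: the distribution functions `F` of `X` and `G` of `Y`
satisfy `F t ≥ G t` for all `t`. -/
def StochasticLE {Ω : Type*} [MeasurableSpace Ω] (μ : Measure Ω) (X Y : Ω → ℝ) : Prop :=
  ∀ t : ℝ, μ {ω | Y ω ≤ t} ≤ μ {ω | X ω ≤ t}

/-! With `q = 1/p ≤ 1/2`, `Y_i = X_i ^ p` of law `ν`, and `u_i = exp a_i ≥ e`, the tail `P(∑ a_i X_i
> t)` equals `H u`, the `ν^n`-measure of `{y ≥ 0 : ∑ log u_i * y_i ^ q > t}`. The map `(u, y) ↦ log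
u * y ^ q` is jointly concave for `u ≥ e`, `y ≥ 0`: by Cauchy–Schwarz this reduces to concavity of
`y ^ (2q)` and of `log² u`, which is where `p ≥ 2` and `a_i ≥ 1` enter. Hence convex combinations of
points in the sets for `u` and `v` lie in the set for the combined parameter, and Prékopa–Leindler
for the product of log-concave laws gives `H (αu + (1-α)v) ≥ min (H u) (H v)`.

So `{u ≥ e : H u ≥ H (exp a)}` is a convex upper set, and by exchangeability it contains every
rearrangement of `exp a`. Weak supmajorization places `exp b` in the convex hull of these
rearrangements plus the nonnegative orthant (`WeaklySupmajorizedBy.mem_of_convex`), so the tail for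
`b` dominates the tail for `a`. -/

open scoped ENNReal

/-! ### Brunn–Minkowski on the line. -/

open Pointwise in
theorem volume_image_affine (a d : ℝ) (ha : 0 ≤ a) (K : Set ℝ) :
    volume ((fun x => a * x + d) '' K) = ENNReal.ofReal a * volume K := by
  have : (fun x => a * x + d) '' K = (fun x => x + d) '' (a • K) := by
    rw [← Set.image_smul, Set.image_image]; rfl
  rw [this, Set.image_add_right, measure_preimage_add_right, Measure.addHaar_smul]
  simp [abs_of_nonneg ha]

/-- With `k = max K` and `l = min L`, the sets `αK + (1-α)l` and `αk + (1-α)L` both lie in `C` and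
meet in at most the point `αk + (1-α)l`, so their volumes add. -/
theorem volume_convexComb_compact {K L C : Set ℝ} {α : ℝ} (h0 : 0 ≤ α) (h1 : α ≤ 1)
    (hK : IsCompact K) (hL : IsCompact L) (hKn : K.Nonempty) (hLn : L.Nonempty)
    (hC : ∀ x ∈ K, ∀ y ∈ L, α * x + (1 - α) * y ∈ C) :
    ENNReal.ofReal α * volume K + ENNReal.ofReal (1 - α) * volume L ≤ volume C := by
  obtain ⟨k, hk, hkmax⟩ := hK.exists_isMaxOn hKn continuousOn_id
  obtain ⟨l, hl, hlmin⟩ := hL.exists_isMinOn hLn continuousOn_id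
  rw [← volume_image_affine α ((1 - α) * l) h0 K,
    ← volume_image_affine (1 - α) (α * k) (by linarith) L]
  set S := (fun x => α * x + (1 - α) * l) '' K
  set T := (fun x => (1 - α) * x + α * k) '' L
  have hT : MeasurableSet T := (hL.image (by fun_prop)).measurableSet
  rw [← measure_union_add_inter S hT]
  have hST : S ∩ T ⊆ {α * k + (1 - α) * l} := by
    rintro _ ⟨⟨x, hx, rfl⟩, ⟨y, hy, h⟩⟩
    have h2 : x ≤ k := hkmax hx
    have h3 : l ≤ y := hlmin hy
    have h4 := mul_le_mul_of_nonneg_left h2 h0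
    have h5 := mul_le_mul_of_nonneg_left h3 (sub_nonneg.2 h1)
    simp only [Set.mem_singleton_iff] at h ⊢
    linarith
  have hz : volume (S ∩ T) = 0 := measure_mono_null hST (by simp)
  rw [hz, add_zero]
  apply measure_mono
  rintro _ (⟨x, hx, rfl⟩ | ⟨x, hx, rfl⟩)
  · exact hC x hx l hl
  · have := hC k hk x hx
    simpa only [add_comm] using this

/-- One-dimensional Brunn–Minkowski inequality. -/
theorem volume_convexComb {A B C : Set ℝ} {α : ℝ} (h0 : 0 ≤ α) (h1 : α ≤ 1)
    (hA : MeasurableSet A) (hB : MeasurableSet B) (hAn : A.Nonempty) (hBn : B.Nonempty)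
    (hC : ∀ x ∈ A, ∀ y ∈ B, α * x + (1 - α) * y ∈ C) :
    ENNReal.ofReal α * volume A + ENNReal.ofReal (1 - α) * volume B ≤ volume C := by
  obtain ⟨a, ha⟩ := hAn
  obtain ⟨b, hb⟩ := hBn
  rw [hA.measure_eq_iSup_isCompact, hB.measure_eq_iSup_isCompact]
  simp only [ENNReal.mul_iSup, iSup_and']
  apply ENNReal.biSup_add_biSup_le' (p := fun K => K ⊆ A ∧ IsCompact K)
    (q := fun K => K ⊆ B ∧ IsCompact K)
  · exact ⟨∅, by simp⟩
  · exact ⟨∅, by simp⟩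
  rintro K ⟨hKA, hK⟩ L ⟨hLB, hL⟩
  -- Inserting `a` and `b` keeps the inner compact approximations nonempty.
  refine le_trans ?_ (volume_convexComb_compact h0 h1 (hK.insert a) (hL.insert b)
    (Set.insert_nonempty _ _) (Set.insert_nonempty _ _) ?_)
  · gcongr <;> exact Set.subset_insert _ _
  · intro x hx y hy
    exact hC x (Set.insert_subset ha hKA hx) y (Set.insert_subset hb hLB hy)

/-- Layer-cake integration of Brunn–Minkowski. Since both suprema are exactly `1`, the superlevel
sets of `f` and `g` are both nonempty for `t < 1` and both empty for `t ≥ 1`, so no level has just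
one of them empty. -/
theorem lintegral_add_le_of_sup_one {f g h : ℝ → ℝ} {α : ℝ} (h0 : 0 ≤ α) (h1 : α ≤ 1)
    (hf : Measurable f) (hg : Measurable g) (hh : Measurable h)
    (hf0 : 0 ≤ f) (hg0 : 0 ≤ g) (hh0 : 0 ≤ h)
    (hf1 : ∀ x, f x ≤ 1) (hg1 : ∀ x, g x ≤ 1)
    (hfs : ∀ t < 1, ∃ x, t < f x) (hgs : ∀ t < 1, ∃ x, t < g x)
    (hfgh : ∀ x y, f x ^ α * g y ^ (1 - α) ≤ h (α * x + (1 - α) * y)) :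
    ENNReal.ofReal α * (∫⁻ x, ENNReal.ofReal (f x)) +
        ENNReal.ofReal (1 - α) * (∫⁻ x, ENNReal.ofReal (g x))
      ≤ ∫⁻ x, ENNReal.ofReal (h x) := by
  have key : ∀ t ∈ Set.Ioi (0 : ℝ),
      ENNReal.ofReal α * volume {x | t < f x} + ENNReal.ofReal (1 - α) * volume {x | t < g x}
        ≤ volume {x | t < h x} := by
    intro t ht
    rcases lt_or_ge t 1 with h | h
    · refine volume_convexComb h0 h1 (measurableSet_lt measurable_const hf)
        (measurableSet_lt measurable_const hg) (hfs t h) (hgs t h) fun x hx y hy => ?_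
      refine lt_of_lt_of_le ?_ (hfgh x y)
      have ht0 : 0 < t := ht
      have hx' : t < f x := hx
      have hy' : t < g y := hy
      have ht' : t = t ^ α * t ^ (1 - α) := by
        rw [← Real.rpow_add ht0]; simp
      rcases h0.eq_or_lt with rfl | h0'
      · simpa using hy
      · calc t = t ^ α * t ^ (1 - α) := ht'
          _ ≤ t ^ α * g y ^ (1 - α) := by
            gcongr
          _ < f x ^ α * g y ^ (1 - α) := by
            have : 0 < g y := ht0.trans hy'
            gcongr
    · have h2 : {x | t < f x} = ∅ := by
        ext x; simpa using (hf1 x).trans h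
      have h3 : {x | t < g x} = ∅ := by
        ext x; simpa using (hg1 x).trans h
      simp [h2, h3]
  rw [lintegral_eq_lintegral_meas_lt _ (Filter.Eventually.of_forall hf0) hf.aemeasurable,
    lintegral_eq_lintegral_meas_lt _ (Filter.Eventually.of_forall hg0) hg.aemeasurable,
    lintegral_eq_lintegral_meas_lt _ (Filter.Eventually.of_forall hh0) hh.aemeasurable]
  calc _ ≤ (∫⁻ t in Set.Ioi (0 : ℝ), ENNReal.ofReal α * volume {x | t < f x})
        + ∫⁻ t in Set.Ioi (0 : ℝ), ENNReal.ofReal (1 - α) * volume {x | t < g x} := by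
        gcongr <;> exact lintegral_const_mul_le _ _
    _ ≤ ∫⁻ t in Set.Ioi (0 : ℝ), (ENNReal.ofReal α * volume {x | t < f x}
        + ENNReal.ofReal (1 - α) * volume {x | t < g x}) := le_lintegral_add _ _
    _ ≤ _ := setLIntegral_mono' measurableSet_Ioi key


/-! ### The Prékopa–Leindler inequality and its tensorization. -/

theorem ENNReal.geom_mean_le_arith_mean2 {α : ℝ} (h0 : 0 < α) (h1 : α < 1) (a b : ℝ≥0∞) :
    a ^ α * b ^ (1 - α) ≤ ENNReal.ofReal α * a + ENNReal.ofReal (1 - α) * b := by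
  have h1' : 0 < 1 - α := sub_pos.2 h1
  have hpq : (α⁻¹).HolderConjugate (1 - α)⁻¹ := by
    rw [Real.holderConjugate_iff]
    exact ⟨(one_lt_inv₀ h0).2 h1, by simp⟩
  have := ENNReal.young_inequality (a ^ α) (b ^ (1 - α)) hpq
  rw [← ENNReal.rpow_mul, ← ENNReal.rpow_mul, mul_inv_cancel₀ h0.ne', mul_inv_cancel₀ h1'.ne',
    ENNReal.ofReal_inv_of_pos h0, ENNReal.ofReal_inv_of_pos h1'] at this
  simpa [div_eq_mul_inv, mul_comm] using this

/-- The measure `ν` satisfies the Prékopa–Leindler inequality with weights `α` and `1 - α`. -/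
def PrekopaLeindler {E : Type*} [AddCommGroup E] [Module ℝ E] [MeasurableSpace E]
    (α : ℝ) (ν : Measure E) : Prop :=
  ∀ f g h : E → ℝ≥0∞, Measurable f → Measurable g → Measurable h →
    (∀ x y, f x ^ α * g y ^ (1 - α) ≤ h (α • x + (1 - α) • y)) →
    (∫⁻ x, f x ∂ν) ^ α * (∫⁻ x, g x ∂ν) ^ (1 - α) ≤ ∫⁻ x, h x ∂ν

/-- Rescaling `f` and `g` to supremum `1` gives the additive inequality, which weighted AM–GM turns
into the multiplicative one; the latter is homogeneous, so the scaling cancels. -/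
theorem prekopaLeindler_of_bounded {α : ℝ} (h0 : 0 < α) (h1 : α < 1) {f g h : ℝ → ℝ≥0∞}
    (hf : Measurable f) (hg : Measurable g) (hh : Measurable h)
    (hfb : ⨆ x, f x ≠ ∞) (hgb : ⨆ x, g x ≠ ∞)
    (H : ∀ x y, f x ^ α * g y ^ (1 - α) ≤ h (α * x + (1 - α) * y)) :
    (∫⁻ x, f x) ^ α * (∫⁻ x, g x) ^ (1 - α) ≤ ∫⁻ x, h x := by
  have h1' : 0 < 1 - α := sub_pos.2 h1
  by_cases hf0 : ⨆ x, f x = 0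
  · have : f = fun _ => 0 := by
      ext x; simpa using (ENNReal.iSup_eq_zero.1 hf0 x)
    simp [this, h0]
  by_cases hg0 : ⨆ x, g x = 0
  · have : g = fun _ => 0 := by
      ext x; simpa using (ENNReal.iSup_eq_zero.1 hg0 x)
    simp [this, h1]
  set M := (⨆ x, f x)⁻¹ with hM
  set N := (⨆ x, g x)⁻¹ with hN
  have hM0 : M ≠ 0 := ENNReal.inv_ne_zero.2 hfb
  have hN0 : N ≠ 0 := ENNReal.inv_ne_zero.2 hgb
  have hMt : M ≠ ∞ := ENNReal.inv_ne_top.2 hf0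
  have hNt : N ≠ ∞ := ENNReal.inv_ne_top.2 hg0
  set K := M ^ α * N ^ (1 - α) with hK
  have hK0 : K ≠ 0 := by
    simp [hK, ENNReal.rpow_eq_zero_iff, hM0, hN0, hMt, hNt]
  have hKt : K ≠ ∞ := ENNReal.mul_ne_top (ENNReal.rpow_ne_top_of_nonneg h0.le hMt)
    (ENNReal.rpow_ne_top_of_nonneg h1'.le hNt)
  have hf1 : ∀ x, f x * M ≤ 1 := fun x => by
    calc f x * M ≤ (⨆ x, f x) * M := by gcongr; exact le_iSup f x
      _ = 1 := ENNReal.mul_inv_cancel hf0 hfb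
  have hg1 : ∀ x, g x * N ≤ 1 := fun x => by
    calc g x * N ≤ (⨆ x, g x) * N := by gcongr; exact le_iSup g x
      _ = 1 := ENNReal.mul_inv_cancel hg0 hgb
  have hsup : ∀ (u : ℝ → ℝ≥0∞), ⨆ x, u x ≠ 0 → ⨆ x, u x ≠ ∞ → (∀ x, u x * (⨆ x, u x)⁻¹ ≤ 1) →
      ∀ t < (1 : ℝ), ∃ x, t < (u x * (⨆ x, u x)⁻¹).toReal := by
    intro u hu0 hut hu1 t ht
    have hlt : ENNReal.ofReal t < 1 := by simpa using ht
    have h2 : ENNReal.ofReal t < ⨆ x, u x * (⨆ x, u x)⁻¹ := by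
      rw [← ENNReal.iSup_mul, ENNReal.mul_inv_cancel hu0 hut]; exact hlt
    obtain ⟨x, hx⟩ := lt_iSup_iff.1 h2
    refine ⟨x, lt_of_not_ge fun hle => hx.not_ge ?_⟩
    rw [← ENNReal.ofReal_toReal ((hu1 x).trans_lt ENNReal.one_lt_top).ne]
    exact ENNReal.ofReal_le_ofReal hle
  have hfin : ∀ {u : ℝ≥0∞}, u ≤ 1 → u ≠ ∞ := fun hu => (hu.trans_lt ENNReal.one_lt_top).ne
  -- Capping `h * K` at `1` makes it finite; the hypothesis survives because the rescaled `f` and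
  -- `g` are at most `1`.
  have main := lintegral_add_le_of_sup_one (f := fun x => (f x * M).toReal)
    (g := fun x => (g x * N).toReal) (h := fun x => (min (h x * K) 1).toReal) h0.le h1.le
    (hf.mul_const M).ennreal_toReal (hg.mul_const N).ennreal_toReal
    ((hh.mul_const K).min measurable_const).ennreal_toReal
    (fun _ => ENNReal.toReal_nonneg) (fun _ => ENNReal.toReal_nonneg)
    (fun _ => ENNReal.toReal_nonneg)
    (fun x => ENNReal.toReal_le_of_le_ofReal zero_le_one (by simpa using hf1 x))
    (fun x => ENNReal.toReal_le_of_le_ofReal zero_le_one (by simpa using hg1 x))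
    (hsup f hf0 hfb hf1) (hsup g hg0 hgb hg1) (fun x y => by
      rw [ENNReal.toReal_rpow, ENNReal.toReal_rpow, ← ENNReal.toReal_mul]
      apply ENNReal.toReal_mono (hfin (min_le_right _ _))
      apply le_min
      · rw [ENNReal.mul_rpow_of_nonneg _ _ h0.le, ENNReal.mul_rpow_of_nonneg _ _ h1'.le,
          mul_mul_mul_comm]
        gcongr
        exact H x y
      · calc _ ≤ (1 : ℝ≥0∞) ^ α * 1 ^ (1 - α) := by
              gcongr
              · exact hf1 x
              · exact hg1 y
          _ = 1 := by simp)
  simp only [ENNReal.ofReal_toReal (hfin (hf1 _)), ENNReal.ofReal_toReal (hfin (hg1 _)),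
    ENNReal.ofReal_toReal (hfin (min_le_right _ _))] at main
  have h2 := (ENNReal.geom_mean_le_arith_mean2 h0 h1 _ _).trans main
  rw [lintegral_mul_const _ hf, lintegral_mul_const _ hg, ENNReal.mul_rpow_of_nonneg _ _ h0.le,
    ENNReal.mul_rpow_of_nonneg _ _ h1'.le, mul_mul_mul_comm] at h2
  have h3 : ∫⁻ x, min (h x * K) 1 ≤ (∫⁻ x, h x) * K := by
    rw [← lintegral_mul_const _ hh]
    exact lintegral_mono fun x => min_le_left _ _
  exact (ENNReal.mul_le_mul_iff_left hK0 hKt).1 (h2.trans h3)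

theorem prekopaLeindler_volume {α : ℝ} (h0 : 0 < α) (h1 : α < 1) :
    PrekopaLeindler α (volume : Measure ℝ) := by
  have h1' : 0 < 1 - α := sub_pos.2 h1
  intro f g h hf hg hh H
  -- Zero integrals are removed first: the truncation limit below needs both factors nonzero to
  -- avoid `0 * ∞`.
  by_cases hf0 : ∫⁻ x, f x = 0
  · simp [hf0, h0]
  by_cases hg0 : ∫⁻ x, g x = 0
  · simp [hg0, h1]
  have htr : ∀ u : ℝ → ℝ≥0∞, Measurable u → Filter.Tendsto
      (fun n : ℕ => ∫⁻ x, min (u x) n) Filter.atTop (nhds (∫⁻ x, u x)) := by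
    intro u hu
    apply lintegral_tendsto_of_tendsto_of_monotone
    · exact fun n => (hu.min measurable_const).aemeasurable
    · exact Filter.Eventually.of_forall fun x m n hmn => by dsimp only; gcongr
    · refine Filter.Eventually.of_forall fun x => ?_
      have := (tendsto_const_nhds (x := u x)).min ENNReal.tendsto_nat_nhds_top
      simpa using this
  have hlim := ENNReal.Tendsto.mul
    (((ENNReal.continuous_rpow_const (y := α)).tendsto _).comp (htr f hf))
    (Or.inl (by simp [ENNReal.rpow_eq_zero_iff, hf0, h0.not_gt]))
    (((ENNReal.continuous_rpow_const (y := 1 - α)).tendsto _).comp (htr g hg))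
    (Or.inl (by simp [ENNReal.rpow_eq_zero_iff, hg0, h1.not_gt]))
  refine le_of_tendsto' hlim fun n => ?_
  refine prekopaLeindler_of_bounded h0 h1 (hf.min measurable_const) (hg.min measurable_const) hh
    ?_ ?_ fun x y => ?_
  · exact ((iSup_le fun x => min_le_right _ _).trans_lt (ENNReal.natCast_lt_top n)).ne
  · exact ((iSup_le fun x => min_le_right _ _).trans_lt (ENNReal.natCast_lt_top n)).ne
  · refine le_trans ?_ (H x y)
    gcongr <;> exact min_le_left _ _

theorem PrekopaLeindler.withDensity {α : ℝ} (h0 : 0 < α) (h1 : α < 1)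
    {E : Type*} [AddCommGroup E] [Module ℝ E] [MeasurableSpace E] {ν : Measure E}
    (hν : PrekopaLeindler α ν) {φ : E → ℝ≥0∞} (hφ : Measurable φ)
    (H : ∀ x y, φ x ^ α * φ y ^ (1 - α) ≤ φ (α • x + (1 - α) • y)) :
    PrekopaLeindler α (ν.withDensity φ) := by
  intro f g h hf hg hh hfgh
  rw [lintegral_withDensity_eq_lintegral_mul _ hφ hf, lintegral_withDensity_eq_lintegral_mul _ hφ hg,
    lintegral_withDensity_eq_lintegral_mul _ hφ hh]
  refine hν _ _ _ (hφ.mul hf) (hφ.mul hg) (hφ.mul hh) fun x y => ?_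
  simp only [Pi.mul_apply]
  rw [ENNReal.mul_rpow_of_nonneg _ _ h0.le, ENNReal.mul_rpow_of_nonneg _ _ (sub_pos.2 h1).le,
    mul_mul_mul_comm]
  exact mul_le_mul' (H x y) (hfgh x y)

/-- Induction on dimension: the `n`-dimensional case, applied to slices, says that the partial
integrals satisfy the one-dimensional hypothesis in the first coordinate. -/
theorem PrekopaLeindler.pi {α : ℝ} {ν : Measure ℝ} [SigmaFinite ν] (hν : PrekopaLeindler α ν)
    (n : ℕ) : PrekopaLeindler α (Measure.pi fun _ : Fin n => ν) := by
  induction n with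
  | zero =>
    intro f g h hf hg hh H
    simp only [Measure.pi_of_empty _ (0 : Fin 0 → ℝ), lintegral_dirac]
    simpa using H 0 0
  | succ n ih =>
    have hint : ∀ u : (Fin (n + 1) → ℝ) → ℝ≥0∞, Measurable u →
        ∫⁻ x, u x ∂(Measure.pi fun _ => ν) =
          ∫⁻ s, ∫⁻ x, u (Fin.cons s x) ∂(Measure.pi fun _ : Fin n => ν) ∂ν := by
      intro u hu
      have hp := (measurePreserving_piFinSuccAbove (fun _ : Fin (n + 1) => ν) 0).symm
      rw [← hp.lintegral_comp hu, lintegral_prod (fun z => u ((MeasurableEquiv.piFinSuccAbove (fun _ => ℝ) 0).symm z))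
        (hu.comp hp.measurable).aemeasurable]
      simp [MeasurableEquiv.piFinSuccAbove, Fin.insertNthEquiv]
    have hcons : Measurable fun z : ℝ × (Fin n → ℝ) => (Fin.cons z.1 z.2 : Fin (n + 1) → ℝ) := by
      refine measurable_pi_iff.2 fun i => ?_
      refine Fin.cases ?_ (fun j => ?_) i
      · simpa using measurable_fst
      · simp only [Fin.cons_succ]; fun_prop
    intro f g h hf hg hh H
    rw [hint f hf, hint g hg, hint h hh]
    have hm : ∀ u : (Fin (n + 1) → ℝ) → ℝ≥0∞, Measurable u → Measurable fun s =>
        ∫⁻ x, u (Fin.cons s x) ∂(Measure.pi fun _ : Fin n => ν) := fun u hu =>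
      (hu.comp hcons).lintegral_prod_right'
    refine hν _ _ _ (hm f hf) (hm g hg) (hm h hh) fun s t => ?_
    have hs : ∀ (u : (Fin (n + 1) → ℝ) → ℝ≥0∞), Measurable u → ∀ s : ℝ,
        Measurable fun x : Fin n → ℝ => u (Fin.cons s x) :=
      fun u hu s => (hu.comp hcons).comp (measurable_const.prodMk measurable_id)
    refine ih _ _ _ (hs f hf s) (hs g hg t) (hs h hh _) fun x y => ?_
    convert H (Fin.cons s x) (Fin.cons t y) using 2
    ext i
    refine Fin.cases ?_ (fun j => ?_) i <;> simp

/-! ### Joint concavity of `log u * y ^ q`. -/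

theorem one_sub_sq_div_two_le {s : ℝ} (hs : 0 ≤ s) : 1 - s ^ 2 / 2 ≤ (1 + s) * Real.exp (-s) := by
  have hd : ∀ x : ℝ, HasDerivAt (fun s : ℝ => (1 + s) * Real.exp (-s) + s ^ 2 / 2)
      (x * (1 - Real.exp (-x))) x := by
    intro x
    have h1 := ((hasDerivAt_id x).const_add 1).mul ((hasDerivAt_id x).neg.exp)
    have h2 := ((hasDerivAt_id x).pow 2).div_const 2
    refine (h1.add h2).congr_deriv ?_
    simp only [id, Pi.neg_apply]
    push_cast
    ring
  have hmono : MonotoneOn (fun s : ℝ => (1 + s) * Real.exp (-s) + s ^ 2 / 2) (Set.Ici 0) := by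
    apply monotoneOn_of_hasDerivWithinAt_nonneg (convex_Ici 0)
      (fun x _ => (hd x).continuousAt.continuousWithinAt) (fun x _ => (hd x).hasDerivWithinAt)
    intro x hx
    rw [interior_Ici] at hx
    have hx' : 0 < x := hx
    have : Real.exp (-x) ≤ 1 := Real.exp_le_one_iff.2 (by linarith)
    exact mul_nonneg hx'.le (by linarith)
  have := hmono (Set.mem_Ici.2 le_rfl) (Set.mem_Ici.2 hs) hs
  simp at this
  linarith

/-- The left side is the tangent line of `r ↦ exp √r` at `m²`, taken at `r = a²`; this function is
convex on `[1, ∞)`. With `s = a - m`, the slope term is `s + s² / (2m)`. -/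
theorem exp_sqrt_tangent {a m : ℝ} (ha : 1 ≤ a) (hm : 1 ≤ m) :
    Real.exp m * (1 + (a ^ 2 - m ^ 2) / (2 * m)) ≤ Real.exp a := by
  have hm0 : 0 < m := by linarith
  have key : 1 + (a ^ 2 - m ^ 2) / (2 * m) ≤ Real.exp (a - m) := by
    rcases le_total m a with h | h
    · refine le_trans ?_ (Real.quadratic_le_exp_of_nonneg (sub_nonneg.2 h))
      have : (a ^ 2 - m ^ 2) / (2 * m) ≤ (a - m) + (a - m) ^ 2 / 2 := by
        rw [div_le_iff₀ (by linarith)]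
        nlinarith [mul_nonneg (sq_nonneg (a - m)) (sub_nonneg.2 hm)]
      linarith
    · have h1 := one_sub_sq_div_two_le (sub_nonneg.2 h)
      rw [neg_sub] at h1
      have h2 : 0 < 1 + (m - a) := by linarith
      have h3 : (1 - (m - a) ^ 2 / 2) / (1 + (m - a)) ≤ Real.exp (a - m) := by
        rw [div_le_iff₀ h2]; linarith
      refine le_trans ?_ h3
      rw [le_div_iff₀ h2]
      have : (a ^ 2 - m ^ 2) / (2 * m) = (a - m) + (a - m) ^ 2 / (2 * m) := by
        field_simp; ring
      rw [this]
      have h4 : (a - m) ^ 2 / (2 * m) * (1 + (m - a)) ≤ (a - m) ^ 2 / 2 := by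
        rw [div_mul_eq_mul_div, div_le_div_iff₀ (by linarith) (by norm_num)]
        nlinarith [mul_nonneg (sq_nonneg (a - m)) (sub_nonneg.2 ha)]
      nlinarith
  calc _ ≤ Real.exp m * Real.exp (a - m) := by gcongr
    _ = Real.exp a := by rw [← Real.exp_add]; ring_nf

/-- Concavity of `log²` on `[e, ∞)`, in exponential coordinates. Averaging the tangent bounds at
`m²`, the mean of `a²` and `b²`, cancels the linear terms. -/
theorem sqrt_le_log_exp {a b α : ℝ} (ha : 1 ≤ a) (hb : 1 ≤ b) (h0 : 0 ≤ α) (h1 : α ≤ 1) :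
    √(α * a ^ 2 + (1 - α) * b ^ 2) ≤ Real.log (α * Real.exp a + (1 - α) * Real.exp b) := by
  set m := √(α * a ^ 2 + (1 - α) * b ^ 2)
  have hsum : 1 ≤ α * a ^ 2 + (1 - α) * b ^ 2 := by
    have e1 := mul_le_mul_of_nonneg_left (one_le_pow₀ ha (n := 2)) h0
    have e2 := mul_le_mul_of_nonneg_left (one_le_pow₀ hb (n := 2)) (sub_nonneg.2 h1)
    linarith
  have hm : 1 ≤ m := Real.one_le_sqrt.2 hsum
  have hm2 : m ^ 2 = α * a ^ 2 + (1 - α) * b ^ 2 := Real.sq_sqrt (by linarith)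
  have hle : Real.exp m ≤ α * Real.exp a + (1 - α) * Real.exp b := by
    have e1 := mul_le_mul_of_nonneg_left (exp_sqrt_tangent ha hm) h0
    have e2 := mul_le_mul_of_nonneg_left (exp_sqrt_tangent hb hm) (sub_nonneg.2 h1)
    have : Real.exp m = α * (Real.exp m * (1 + (a ^ 2 - m ^ 2) / (2 * m))) +
        (1 - α) * (Real.exp m * (1 + (b ^ 2 - m ^ 2) / (2 * m))) := by
      have : α * ((a ^ 2 - m ^ 2) / (2 * m)) + (1 - α) * ((b ^ 2 - m ^ 2) / (2 * m)) = 0 := by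
        rw [mul_div_assoc', mul_div_assoc', ← add_div, hm2]; ring_nf
      linear_combination - Real.exp m * this
    linarith
  calc m = Real.log (Real.exp m) := (Real.log_exp m).symm
    _ ≤ _ := Real.log_le_log (Real.exp_pos _) hle

/-- Joint concavity of `(u, y) ↦ log u * y ^ q` on `[e, ∞) × [0, ∞)` for `q ≤ 1 / 2`. -/
theorem concaveOn_log_mul_rpow {u v y z α q : ℝ} (hu : Real.exp 1 ≤ u) (hv : Real.exp 1 ≤ v)
    (hy : 0 ≤ y) (hz : 0 ≤ z) (h0 : 0 ≤ α) (h1 : α ≤ 1) (hq0 : 0 < q) (hq : q ≤ 1 / 2) :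
    α * (Real.log u * y ^ q) + (1 - α) * (Real.log v * z ^ q) ≤
      Real.log (α * u + (1 - α) * v) * (α * y + (1 - α) * z) ^ q := by
  have hu0 : 0 < u := (Real.exp_pos 1).trans_le hu
  have hv0 : 0 < v := (Real.exp_pos 1).trans_le hv
  have hlu : 1 ≤ Real.log u := (Real.le_log_iff_exp_le hu0).2 hu
  have hlv : 1 ≤ Real.log v := (Real.le_log_iff_exp_le hv0).2 hv
  have hlog := sqrt_le_log_exp hlu hlv h0 h1
  rw [Real.exp_log hu0, Real.exp_log hv0] at hlog
  have h1' := sub_nonneg.2 h1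
  set c := Real.log (α * u + (1 - α) * v)
  have hhalf : ∀ {w : ℝ}, 0 ≤ w → w ^ q = √(w ^ (2 * q)) := by
    intro w hw
    rw [Real.sqrt_eq_rpow, ← Real.rpow_mul hw]; congr 1; ring
  have hconc : α * y ^ (2 * q) + (1 - α) * z ^ (2 * q) ≤ (α * y + (1 - α) * z) ^ (2 * q) := by
    have := (Real.concaveOn_rpow (p := 2 * q) (by linarith) (by linarith)).2
      (Set.mem_Ici.2 hy) (Set.mem_Ici.2 hz) h0 h1' (by ring)
    simpa using this
  have hw : 0 ≤ α * y + (1 - α) * z := by positivity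
  rw [hhalf hy, hhalf hz, hhalf hw]
  have hY : 0 ≤ y ^ (2 * q) := by positivity
  have hZ : 0 ≤ z ^ (2 * q) := by positivity
  set Y := y ^ (2 * q)
  set Z := z ^ (2 * q)
  set A := Real.log u
  set B := Real.log v
  -- Cauchy–Schwarz, with explicit defect `α(1-α)(A√Z - B√Y)²`.
  calc α * (A * √Y) + (1 - α) * (B * √Z)
      ≤ √((α * A ^ 2 + (1 - α) * B ^ 2) * (α * Y + (1 - α) * Z)) := by
        apply Real.le_sqrt_of_sq_le
        have hsY := Real.sq_sqrt hY
        have hsZ := Real.sq_sqrt hZ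
        have : (α * A ^ 2 + (1 - α) * B ^ 2) * (α * Y + (1 - α) * Z)
            - (α * (A * √Y) + (1 - α) * (B * √Z)) ^ 2
            = α * (1 - α) * (A * √Z - B * √Y) ^ 2 := by
          linear_combination (-(α ^ 2 * A ^ 2 + α * (1 - α) * B ^ 2)) * hsY
            - ((1 - α) ^ 2 * B ^ 2 + α * (1 - α) * A ^ 2) * hsZ
        have h3 : 0 ≤ α * (1 - α) * (A * √Z - B * √Y) ^ 2 := by positivity
        linarith
    _ = √(α * A ^ 2 + (1 - α) * B ^ 2) * √(α * Y + (1 - α) * Z) := Real.sqrt_mul (by positivity) _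
    _ ≤ c * √((α * y + (1 - α) * z) ^ (2 * q)) :=
        mul_le_mul hlog (Real.sqrt_le_sqrt hconc) (Real.sqrt_nonneg _)
          ((Real.sqrt_nonneg _).trans hlog)

/-! ### Weak supmajorization and convex upper sets. -/

/-- Abel summation inequality. -/
theorem sum_mul_nonneg_of_antitone {n : ℕ} {d w : Fin n → ℝ} (hd : Antitone d) (hd0 : ∀ i, 0 ≤ d i)
    (hw : ∀ j, 0 ≤ ∑ i, if i ≤ j then w i else 0) : 0 ≤ ∑ i, d i * w i := by
  induction n with
  | zero => simp
  | succ n ih =>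
    -- Subtracting the last, smallest value of `d` leaves an antitone nonnegative sequence on `n`
    -- indices.
    have h1 : ∑ i, d i * w i = ∑ i : Fin n, (d i.castSucc - d (Fin.last n)) * w i.castSucc
        + d (Fin.last n) * ∑ i, w i := by
      rw [Fin.sum_univ_castSucc, Fin.sum_univ_castSucc w, mul_add, Finset.mul_sum, ← add_assoc,
        ← Finset.sum_add_distrib]
      congr 2; ext i; ring
    rw [h1]
    apply add_nonneg
    · apply ih (d := fun i => d i.castSucc - d (Fin.last n)) (w := fun i => w i.castSucc)
      · intro i j hij
        have := hd (Fin.castSucc_le_castSucc_iff.2 hij)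
        dsimp only; linarith
      · intro i
        have := hd (Fin.le_last i.castSucc)
        linarith
      · intro j
        have := hw j.castSucc
        rw [Fin.sum_univ_castSucc] at this
        simpa [Fin.castSucc_lt_last, not_le.2 (Fin.castSucc_lt_last j)] using this
    · apply mul_nonneg (hd0 _)
      simpa [Fin.le_last] using hw (Fin.last n)

theorem antitone_comp_sort_neg {n : ℕ} (c : Fin n → ℝ) : Antitone (c ∘ Tuple.sort (-c)) := by
  intro i j hij
  have := Tuple.monotone_sort (-c) hij
  simpa using this

theorem sum_mul_comp_perm_le_of_weaklySupmajorizedBy {n : ℕ} {x y c : Fin n → ℝ}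
    (h : WeaklySupmajorizedBy x y) (hc : ∀ i, 0 ≤ c i) :
    ∃ σ : Equiv.Perm (Fin n), ∑ i, c i * y (σ i) ≤ ∑ i, c i * x i := by
  set τ := Tuple.sort (-c)
  -- This permutation pairs the largest coefficients with the smallest entries of `y`. The
  -- rearrangement inequality handles `x`, and Abel summation compares the two sorted sums.
  refine ⟨τ.symm.trans (Tuple.sort y), ?_⟩
  have hanti : Antitone (c ∘ τ) := antitone_comp_sort_neg c
  have hmono : Monotone (incArrangement x) := Tuple.monotone_sort x
  have hre : ∑ i, (c ∘ τ) i * incArrangement x i ≤ ∑ i, c i * x i := by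
    have hav : Antivary (c ∘ τ) (incArrangement x) := hanti.antivary hmono
    have := hav.sum_mul_le_sum_mul_comp_perm (σ := τ.trans (Tuple.sort x).symm)
    refine this.trans_eq ?_
    rw [← Equiv.sum_comp τ (fun i => c i * x i)]
    simp [incArrangement]
  have habel : ∑ i, (c ∘ τ) i * incArrangement y i ≤ ∑ i, (c ∘ τ) i * incArrangement x i := by
    have := sum_mul_nonneg_of_antitone (w := fun i => incArrangement x i - incArrangement y i)
      hanti (fun i => hc _) (fun j => by
        have := h j
        rw [← Finset.sum_filter, Finset.sum_sub_distrib]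
        have e : Finset.univ.filter (fun i => i ≤ j) = Finset.Iic j := by ext; simp
        rw [e]; linarith)
    simp only [mul_sub, Finset.sum_sub_distrib] at this
    linarith
  refine le_trans (le_of_eq ?_) (habel.trans hre)
  rw [← Equiv.sum_comp τ (fun i => c i * _)]
  simp [incArrangement]

open Pointwise in
/-- A convex upper set containing all rearrangements of `y` contains every vector weakly
supmajorized by `y`. -/
theorem WeaklySupmajorizedBy.mem_of_convex {n : ℕ} {x y : Fin n → ℝ}
    (h : WeaklySupmajorizedBy x y) {K : Set (Fin n → ℝ)} (hK : Convex ℝ K) (hup : IsUpperSet K)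
    (hperm : ∀ σ : Equiv.Perm (Fin n), y ∘ σ ∈ K) : x ∈ K := by
  set S : Set (Fin n → ℝ) := Set.range fun σ : Equiv.Perm (Fin n) => y ∘ σ
  have hS : S.Finite := Set.finite_range _
  -- `T` is closed and convex, so a point outside it would be strictly separated by a linear
  -- functional.
  set T := convexHull ℝ S + Set.Ici (0 : Fin n → ℝ)
  have hTK : T ⊆ K := by
    rintro _ ⟨a, ha, z, hz, rfl⟩
    have : a ∈ K := convexHull_min (by rintro _ ⟨σ, rfl⟩; exact hperm σ) hK ha
    exact hup (le_add_of_nonneg_right hz) this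
  apply hTK
  by_contra hx
  have hTconv : Convex ℝ T := (convex_convexHull ℝ S).add (convex_Ici 0)
  have hTclosed : IsClosed T := isClosed_Ici.add_left_of_isCompact (hS.isCompact_convexHull ℝ)
  obtain ⟨l, u, hlx, hlT⟩ := geometric_hahn_banach_point_closed hTconv hTclosed hx
  set c : Fin n → ℝ := fun i => l (Pi.single i 1)
  have hl : ∀ z, l z = ∑ i, c i * z i := by
    intro z
    conv_lhs => rw [pi_eq_sum_univ' z]
    simp only [map_sum, map_smul, smul_eq_mul, c, mul_comm]
  have hmem : ∀ (σ : Equiv.Perm (Fin n)) (z : Fin n → ℝ), 0 ≤ z → y ∘ σ + z ∈ T := fun σ z hz =>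
    Set.add_mem_add (subset_convexHull ℝ S ⟨σ, rfl⟩) hz
  -- `l` is bounded below on `T`, which is stable under adding nonnegative vectors, so no
  -- coefficient is negative. The `k` used in `h4` would bring the value down to exactly `u`.
  have hc : ∀ i, 0 ≤ c i := by
    intro i
    by_contra! hi
    have h2 : ∀ k : ℝ, 0 ≤ k → u < l y + k * c i := by
      intro k hk
      have := hlT _ (hmem 1 (k • Pi.single i 1) (smul_nonneg hk (Pi.single_nonneg.2 zero_le_one)))
      simpa [c] using this
    have h3 := h2 0 le_rfl
    have h4 := h2 ((l y - u) / (-c i)) (div_nonneg (by linarith) (by linarith))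
    have h5 : (l y - u) / (-c i) * c i = -(l y - u) := by
      rw [div_neg, neg_mul, div_mul_cancel₀ _ hi.ne]
    linarith
  obtain ⟨σ, hσ⟩ := sum_mul_comp_perm_le_of_weaklySupmajorizedBy h hc
  have h6 := hlT _ (hmem σ 0 le_rfl)
  rw [add_zero, hl] at h6
  rw [hl] at hlx
  simp only [Function.comp] at h6
  linarith

/-! ### Quasi-concavity of the tail probability. -/

theorem HasLogConcaveDensity.prekopaLeindler {Ω : Type*} [MeasurableSpace Ω] {μ : Measure Ω}
    {X : Ω → ℝ} (h : HasLogConcaveDensity μ X) {α : ℝ} (h0 : 0 < α) (h1 : α < 1) :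
    PrekopaLeindler α (μ.map X) := by
  obtain ⟨g, ⟨hgm, hg0, hg⟩, -, -, hlc⟩ := h
  rw [hg, Measure.restrict_univ]
  refine (prekopaLeindler_volume h0 h1).withDensity h0 h1 hgm.ennreal_ofReal fun x y => ?_
  have hx := hg0 x (Set.mem_univ x)
  have hy := hg0 y (Set.mem_univ y)
  rw [ENNReal.ofReal_rpow_of_nonneg hx h0.le, ENNReal.ofReal_rpow_of_nonneg hy (sub_pos.2 h1).le,
    ← ENNReal.ofReal_mul (by positivity)]
  exact ENNReal.ofReal_le_ofReal
    (hlc x (Set.mem_univ x) y (Set.mem_univ y) α ⟨h0.le, h1.le⟩)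

/-- Prékopa–Leindler for indicators bounds `ν C` below by the weighted geometric mean of `ν A` and
`ν B`, hence by their minimum. -/
theorem PrekopaLeindler.min_measure_le {E : Type*} [AddCommGroup E] [Module ℝ E]
    [MeasurableSpace E] {α : ℝ} (h0 : 0 < α) (h1 : α < 1) {ν : Measure E}
    (hν : PrekopaLeindler α ν) {A B C : Set E} (hA : MeasurableSet A) (hB : MeasurableSet B)
    (hC : MeasurableSet C) (h : ∀ x ∈ A, ∀ y ∈ B, α • x + (1 - α) • y ∈ C) :
    min (ν A) (ν B) ≤ ν C := by
  have h1' : 0 < 1 - α := sub_pos.2 h1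
  have key := hν (A.indicator 1) (B.indicator 1) (C.indicator 1) (measurable_one.indicator hA)
    (measurable_one.indicator hB) (measurable_one.indicator hC) fun x y => by
      by_cases hx : x ∈ A
      · by_cases hy : y ∈ B
        · simp [hx, hy, h x hx y hy]
        · simp [hy, h1]
      · simp [hx, h0]
  rw [lintegral_indicator_one hA, lintegral_indicator_one hB, lintegral_indicator_one hC] at key
  refine le_trans ?_ key
  calc min (ν A) (ν B) = min (ν A) (ν B) ^ α * min (ν A) (ν B) ^ (1 - α) := by
        rw [← ENNReal.rpow_add_of_nonneg _ _ h0.le h1'.le]; simp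
    _ ≤ _ := by
        gcongr
        · exact min_le_left _ _
        · exact min_le_right _ _

/-- The set of nonnegative `y` for which `∑ i, log (u i) * y i ^ q` exceeds `t`. -/
def logWeightedSuperlevel {n : ℕ} (q t : ℝ) (u : Fin n → ℝ) : Set (Fin n → ℝ) :=
  {y | (∀ i, 0 ≤ y i) ∧ t < ∑ i, Real.log (u i) * y i ^ q}

theorem measurableSet_logWeightedSuperlevel {n : ℕ} (q t : ℝ) (u : Fin n → ℝ) :
    MeasurableSet (logWeightedSuperlevel q t u) := by
  have h : logWeightedSuperlevel q t u =
      (⋂ i, {y | 0 ≤ y i}) ∩ {y | t < ∑ i, Real.log (u i) * y i ^ q} := by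
    ext; simp [logWeightedSuperlevel]
  rw [h]
  exact (MeasurableSet.iInter fun i => measurableSet_le measurable_const (measurable_pi_apply i)).inter
    (measurableSet_lt measurable_const (by fun_prop))

theorem logWeightedSuperlevel_mono {n : ℕ} {q t : ℝ} {u v : Fin n → ℝ} (hu : ∀ i, 0 < u i)
    (huv : u ≤ v) : logWeightedSuperlevel q t u ⊆ logWeightedSuperlevel q t v := by
  rintro y ⟨hy, ht⟩
  refine ⟨hy, ht.trans_le (Finset.sum_le_sum fun i _ => ?_)⟩
  exact mul_le_mul_of_nonneg_right (Real.log_le_log (hu i) (huv i)) (Real.rpow_nonneg (hy i) q)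

theorem convexComb_mem_logWeightedSuperlevel {n : ℕ} {q t α : ℝ} (hq0 : 0 < q) (hq : q ≤ 1 / 2)
    (h0 : 0 ≤ α) (h1 : α ≤ 1) {u v y z : Fin n → ℝ} (hu : ∀ i, Real.exp 1 ≤ u i)
    (hv : ∀ i, Real.exp 1 ≤ v i) (hy : y ∈ logWeightedSuperlevel q t u)
    (hz : z ∈ logWeightedSuperlevel q t v) :
    α • y + (1 - α) • z ∈ logWeightedSuperlevel q t (α • u + (1 - α) • v) := by
  have h1' : 0 ≤ 1 - α := sub_nonneg.2 h1
  refine ⟨fun i => ?_, ?_⟩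
  · have := hy.1 i
    have := hz.1 i
    simp only [Pi.add_apply, Pi.smul_apply, smul_eq_mul]
    positivity
  · calc t < α * (∑ i, Real.log (u i) * y i ^ q) + (1 - α) * ∑ i, Real.log (v i) * z i ^ q := by
          have e1 := hy.2
          have e2 := hz.2
          rcases h0.eq_or_lt with rfl | h0'
          · simpa using e2
          · have e3 := mul_lt_mul_of_pos_left e1 h0'
            have e4 := mul_le_mul_of_nonneg_left e2.le h1'
            linarith
      _ ≤ _ := by
          rw [Finset.mul_sum, Finset.mul_sum, ← Finset.sum_add_distrib]
          exact Finset.sum_le_sum fun i _ =>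
            concaveOn_log_mul_rpow (hu i) (hv i) (hy.1 i) (hz.1 i) h0 h1 hq0 hq

theorem pi_logWeightedSuperlevel_comp_perm {n : ℕ} (ν : Measure ℝ) [SigmaFinite ν] (q t : ℝ)
    (u : Fin n → ℝ) (σ : Equiv.Perm (Fin n)) :
    Measure.pi (fun _ => ν) (logWeightedSuperlevel q t (u ∘ σ)) =
      Measure.pi (fun _ => ν) (logWeightedSuperlevel q t u) := by
  have hp := measurePreserving_piCongrLeft (fun _ : Fin n => ν) σ
  rw [← hp.measure_preimage (measurableSet_logWeightedSuperlevel q t u).nullMeasurableSet]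
  congr 1
  ext y
  have e : ∀ i, MeasurableEquiv.piCongrLeft (fun _ : Fin n => ℝ) σ y (σ i) = y i := fun i =>
    Equiv.piCongrLeft_apply_apply (fun _ : Fin n => ℝ) σ y i
  simp only [logWeightedSuperlevel, Set.mem_preimage, Set.mem_ofPred_eq, Function.comp]
  rw [← Equiv.sum_comp σ (fun i => Real.log (u i) * _),
    ← σ.forall_congr_right (q := fun i => 0 ≤ MeasurableEquiv.piCongrLeft (fun _ => ℝ) σ y i)]
  simp only [e]

theorem pi_logWeightedSuperlevel_le {n : ℕ} {ν : Measure ℝ} [SigmaFinite ν]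
    (hν : ∀ α : ℝ, 0 < α → α < 1 → PrekopaLeindler α ν) {q : ℝ} (hq0 : 0 < q) (hq : q ≤ 1 / 2)
    (t : ℝ) {x y : Fin n → ℝ} (hy : ∀ i, Real.exp 1 ≤ y i) (hxy : WeaklySupmajorizedBy x y) :
    Measure.pi (fun _ => ν) (logWeightedSuperlevel q t y) ≤
      Measure.pi (fun _ => ν) (logWeightedSuperlevel q t x) := by
  set H : (Fin n → ℝ) → ℝ≥0∞ := fun u => Measure.pi (fun _ => ν) (logWeightedSuperlevel q t u)
  -- The constraint `u ≥ e` is part of the set because joint concavity is only available there.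
  have hmem : x ∈ {u : Fin n → ℝ | (∀ i, Real.exp 1 ≤ u i) ∧ H y ≤ H u} := by
    refine hxy.mem_of_convex ?_ ?_ ?_
    · rw [convex_iff_forall_pos]
      rintro u ⟨hu, hHu⟩ v ⟨hv, hHv⟩ α β h0 hβ hαβ
      obtain rfl : β = 1 - α := by linarith
      have h1 : α < 1 := by linarith
      refine ⟨fun i => ?_, ?_⟩
      · have e1 := mul_le_mul_of_nonneg_left (hu i) h0.le
        have e2 := mul_le_mul_of_nonneg_left (hv i) hβ.le
        simp only [Pi.add_apply, Pi.smul_apply, smul_eq_mul]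
        linarith
      · refine (le_min hHu hHv).trans ?_
        exact ((hν α h0 h1).pi n).min_measure_le h0 h1 (measurableSet_logWeightedSuperlevel q t u)
          (measurableSet_logWeightedSuperlevel q t v) (measurableSet_logWeightedSuperlevel q t _)
          fun _ hx _ hy => convexComb_mem_logWeightedSuperlevel hq0 hq h0.le h1.le hu hv hx hy
    · rintro u v huv ⟨hu, hHu⟩
      exact ⟨fun i => (hu i).trans (huv i), hHu.trans (measure_mono
        (logWeightedSuperlevel_mono (fun i => (Real.exp_pos 1).trans_le (hu i)) huv))⟩
    · exact fun σ => ⟨fun i => hy (σ i), (pi_logWeightedSuperlevel_comp_perm ν q t y σ).ge⟩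
  exact hmem.2

/-! ### Transfer to the random variables. -/

theorem IsDensityOn.ae_mem {Ω : Type*} [MeasurableSpace Ω] {μ : Measure Ω} {X : Ω → ℝ}
    (hX : AEMeasurable X μ) {A : Set ℝ} (hA : MeasurableSet A) {f : ℝ → ℝ}
    (h : IsDensityOn μ X A f) : ∀ᵐ ω ∂μ, X ω ∈ A := by
  refine ae_of_ae_map hX ?_
  rw [h.2.2]
  exact (withDensity_absolutelyContinuous _ _).ae_le (ae_restrict_mem hA)

theorem corollary3p4 {Ω : Type*} [MeasurableSpace Ω] (μ : Measure Ω) [IsProbabilityMeasure μ]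
    (n : ℕ) [NeZero n] (p : ℝ) (hp : 2 ≤ p)
    (X : Fin n → Ω → ℝ) (hX : ∀ i, Measurable (X i))
    (hindep : iIndepFun X μ) (hident : ∀ i, IdentDistrib (X i) (X 0) μ μ)
    (f : ℝ → ℝ) (hf : IsDensityOn μ (X 0) (Set.Ici 0) f)
    (hlc : HasLogConcaveDensity μ (fun ω => X 0 ω ^ p))
    (a b : Fin n → ℝ) (ha : ∀ i, 1 ≤ a i) (hb : ∀ i, 1 ≤ b i)
    (hab : WeaklySupmajorizedBy (fun i => Real.exp (b i)) (fun i => Real.exp (a i))) :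
    StochasticLE μ (fun ω => ∑ i, a i * X i ω) (fun ω => ∑ i, b i * X i ω) := by
  intro t
  have hp0 : 0 < p := by linarith
  have hpow : Measurable fun x : ℝ => x ^ p := by fun_prop
  have hY : ∀ i, Measurable fun ω => X i ω ^ p := fun i => hpow.comp (hX i)
  set ν := μ.map (fun ω => X 0 ω ^ p)
  have : IsProbabilityMeasure ν := Measure.isProbabilityMeasure_map (hY 0).aemeasurable
  have hjoint : μ.map (fun ω i => X i ω ^ p) = Measure.pi fun _ => ν := by
    rw [(iIndepFun_iff_map_fun_eq_pi_map fun i => (hY i).aemeasurable).1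
      (hindep.comp (fun _ x => x ^ p) fun _ => hpow)]
    congr 1
    ext1 i
    exact ((hident i).comp hpow).map_eq
  have hnonneg : ∀ᵐ ω ∂μ, ∀ i, 0 ≤ X i ω := by
    rw [ae_all_iff]
    intro i
    have h0 : ∀ᵐ ω ∂μ, X 0 ω ∈ Set.Ici (0 : ℝ) := hf.ae_mem (hX 0).aemeasurable measurableSet_Ici
    exact (hident i).symm.ae_mem_snd measurableSet_Ici h0
  -- Almost surely `X i ≥ 0`, so `(X i ^ p) ^ p⁻¹ = X i` and the complement is the strict superlevel
  -- event for `Y = X ^ p`.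
  have hprob : ∀ c : Fin n → ℝ, μ {ω | ∑ i, c i * X i ω ≤ t}ᶜ =
      Measure.pi (fun _ => ν) (logWeightedSuperlevel p⁻¹ t fun i => Real.exp (c i)) := by
    intro c
    rw [← hjoint, Measure.map_apply (measurable_pi_lambda _ hY)
      (measurableSet_logWeightedSuperlevel _ _ _)]
    refine measure_congr ?_
    filter_upwards [hnonneg] with ω hω
    refine propext ?_
    change ¬ (∑ i, c i * X i ω ≤ t) ↔ (∀ i, 0 ≤ X i ω ^ p) ∧
      t < ∑ i, Real.log (Real.exp (c i)) * (X i ω ^ p) ^ p⁻¹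
    simp [Real.rpow_rpow_inv (hω _) hp0.ne', fun i => Real.rpow_nonneg (hω i) p]
  have hmeas : ∀ c : Fin n → ℝ, MeasurableSet {ω | ∑ i, c i * X i ω ≤ t} := fun c =>
    measurableSet_le (by fun_prop) measurable_const
  have hq : p⁻¹ ≤ 1 / 2 := by rw [one_div]; exact inv_anti₀ two_pos hp
  have key : μ {ω | ∑ i, a i * X i ω ≤ t}ᶜ ≤ μ {ω | ∑ i, b i * X i ω ≤ t}ᶜ := by
    rw [hprob, hprob]
    exact pi_logWeightedSuperlevel_le (fun α h0 h1 => hlc.prekopaLeindler h0 h1)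
      (inv_pos.2 hp0) hq t (fun i => Real.exp_le_exp.2 (ha i)) hab
  have h1 := prob_compl_eq_one_sub (μ := μ) (hmeas a).compl
  have h2 := prob_compl_eq_one_sub (μ := μ) (hmeas b).compl
  rw [compl_compl] at h1 h2
  dsimp only
  rw [h1, h2]
  exact tsub_le_tsub_left key 1
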